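/- Let $k$ be a field of characteristic $0$ and $K=k[[h]]$. Let $A_0$ be a left noetherian associative unital $k$-algebra and let $A_h$ be a deformation of $A_0$: an associative unital $K$-algebra that is topologically free as a $K$-module (i.e. isomorphic to $V[[h]]$ for some $k$-vector space $V$), together with an isomorphism of $k$-algebras $A_h/hA_h\simeq A_0$. Assume that $k$ carries a left $A_0$-module structure, compatible with its $k$-vector space structure, for which there is an integer $d$ with $$\mathrm{Ext}^i_{A_0}(k,A_0)=0\ \text{ for } i\neq d,\qquad \mathrm{Ext}^d_{A_0}(k,A_0)\simeq k \ \text{ as a } k\text{-vector space}.$$ Assume that $K$ carries a left $A_h$-module structure, compatible with its $K$-module structure, which reduces modulo $h$ to the given $A_0$-module structure on $k=K/hK$. For a ring $A$ and a left $A$-module $M$, the group $\mathrm{Ext}^i_A(M,A)$ is a right $A$-module, $a\in A$ acting through the map induced by right multiplication by $a$ on $A$. Then: (a) $\mathrm{Ext}^i_{A_h}(K,A_h)=0$ for all $i\neq d$. (b) $\mathrm{Ext}^d_{A_h}(K,A_h)$ is a free $K$-module of rank one, and its right $A_h$-module structure lifts the right $A_0$-module structure on $\mathrm{Ext}^d_{A_0}(k,A_0)$: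 there is a surjective additive map $p:\mathrm{Ext}^d_{A_h}(K,A_h)\to\mathrm{Ext}^d_{A_0}(k,A_0)$ with kernel $h\,\mathrm{Ext}^d_{A_h}(K,A_h)$, such that $p(cx)=c(0)\,p(x)$ and $p(x\cdot a)=p(x)\cdot\bar a$ for all $c\in K$, $a\in A_h$ and all $x$, where $\bar a\in A_0$ is the class of $a$ modulo $h$. Consequently there is a unique homomorphism of $K$-algebras $\theta_{A_h}:A_h\to K$ (a character) such that $x\cdot a=\theta_{A_h}(a)\,x$ for all $a\in A_h$ and $x\in\mathrm{Ext}^d_{A_h}(K,A_h)$. -/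

import Mathlib

open CategoryTheory CategoryTheory.Abelian PowerSeries MulOpposite
open scoped ModuleCat.Algebra

universe u

/-- A module `M` over `k⟦X⟧` is topologically free if it is isomorphic to the module `V⟦X⟧` of
formal power series with coefficients in some `k`-vector space `V`. A series is given by its
sequence of coefficients, and `k⟦X⟧` acts by the Cauchy product. -/
def IsTopologicallyFree (k : Type u) [Field k] (M : Type u) [AddCommGroup M]
    [Module k⟦X⟧ M] : Prop :=
  ∃ (V : Type u) (_ : AddCommGroup V) (_ : Module k V) (e : M ≃+ (ℕ → V)),
    ∀ (c : k⟦X⟧) (m : M) (n : ℕ),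
      e (c • m) n = ∑ p ∈ Finset.HasAntidiagonal.antidiagonal n, coeff p.1 c • e m p.2

/-- A deformation of the associative `k`-algebra `A₀`: a topologically free `k⟦X⟧`-algebra `Ah`
with an isomorphism of `k`-algebras `Ah / X Ah ≃ A₀`. The isomorphism is recorded as a surjective
ring homomorphism `Ah → A₀` with kernel `X Ah`, compatible with the scalars. -/
structure Deformation (k : Type u) [Field k] (A₀ : Type u) [Ring A₀] [Algebra k A₀]
    (Ah : Type u) [Ring Ah] [Algebra k⟦X⟧ Ah] where
  topologicallyFree : IsTopologicallyFree k Ah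
  red : Ah →+* A₀
  red_surjective : Function.Surjective red
  red_eq_zero_iff : ∀ a : Ah, red a = 0 ↔ ∃ b : Ah, a = (X : k⟦X⟧) • b
  red_algebraMap : ∀ c : k⟦X⟧, red (algebraMap k⟦X⟧ Ah c) = algebraMap k A₀ (constantCoeff c)

/-- Right multiplication by `a`, as an endomorphism of the left `A`-module `A`. -/
def rightMul {A : Type u} [Ring A] (a : A) : ModuleCat.of A A ⟶ ModuleCat.of A A :=
  ModuleCat.ofHom
    { toFun := fun x => x * a
      map_add' := fun x y => add_mul x y a
      map_smul' := fun r x => mul_assoc r x a }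

/-- The group `Ext^n_A(M, A)`, for left `A`-modules `M` and `A`. -/
abbrev ExtSelf (A : Type u) [Ring A] (M : Type u) [AddCommGroup M] [Module A M] (n : ℕ) : Type u :=
  Ext.{u} (ModuleCat.of A M) (ModuleCat.of A A) n

/-- The right `A`-module structure on `Ext^n_A(M, A)`: the element `a` acts through the
endomorphism of `Ext^n_A(M, A)` induced by right multiplication by `a` on `A`. -/
noncomputable instance ExtSelf.rightModule {A : Type u} [Ring A] {M : Type u} [AddCommGroup M]
    [Module A M] {n : ℕ} : Module Aᵐᵒᵖ (ExtSelf A M n) where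
  smul a x := x.comp (Ext.mk₀ (rightMul a.unop)) (add_zero n)
  one_smul x := by
    change x.comp (Ext.mk₀ (rightMul 1)) (add_zero n) = x
    have : rightMul (1 : A) = 𝟙 _ := by ext; simp [rightMul]
    rw [this, Ext.comp_mk₀_id]
  mul_smul a b x := by
    change x.comp (Ext.mk₀ (rightMul (b.unop * a.unop))) (add_zero n) =
      (x.comp (Ext.mk₀ (rightMul b.unop)) (add_zero n)).comp (Ext.mk₀ (rightMul a.unop))
        (add_zero n)
    have : rightMul (b.unop * a.unop) = rightMul b.unop ≫ rightMul a.unop := by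
      ext; simp [rightMul]
    rw [this, Ext.comp_assoc_of_third_deg_zero, Ext.mk₀_comp_mk₀]
  smul_zero a := Ext.zero_comp (X := ModuleCat.of A M) (n := n) (Ext.mk₀ (rightMul a.unop)) n (add_zero n)
  smul_add a x y := Ext.add_comp _ _ _ _
  add_smul a b x := by
    change x.comp (Ext.mk₀ (rightMul (a.unop + b.unop))) (add_zero n) = _
    have : rightMul (a.unop + b.unop) = rightMul a.unop + rightMul b.unop := by
      ext; simp [rightMul]
    rw [this, Ext.mk₀_add, Ext.comp_add]
    rfl
  zero_smul x := by
    change x.comp (Ext.mk₀ (rightMul 0)) (add_zero n) = 0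
    have : rightMul (0 : A) = 0 := by ext; simp [rightMul]
    rw [this, Ext.mk₀_zero, Ext.comp_zero]

/-! Write E^i for Ext^i over `Ah` of K with values in `Ah`. Since h is central and regular, 0 → `Ah`
→ `Ah` → `A₀` → 0 (multiplication by h, then reduction) is exact and gives a long exact sequence.
Its third term Ext^i(K, `A₀`) over `Ah` is Ext^i(k, `A₀`) over `A₀`, because K has no h-torsion
(`extChange_bijective`). Hence E^i/hE^i embeds in Ext^i(k, `A₀`), with equality when E^(i+1) = 0,
and the h-torsion of E^i comes from Ext^(i-1)(k, `A₀`).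

To pass from E^i/hE^i to E^i one needs Nakayama. Completeness takes the place of finite generation:
bijectivity of (s_n) ↦ (s_n - φ s_(n+1)) on sequences passes to cokernels, unlike h-adic
separatedness, so E^i inherits it from `Ah` by dimension shifting (`isDerivedComplete_ext`). Thus
E^i = 0 for i ≠ d, while E^d is torsion-free and generated by a lift of a generator of Ext^d(k,
`A₀`). The right action commutes with K, so on a free module of rank one it is a character. -/

/-! ### Derived completeness and Nakayama's lemma -/

/-- An abelian group with an endomorphism `φ` is derived complete along `φ` if the telescopic
equations `s n = y n + φ (s (n + 1))` always have one and only one solution `s`. -/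
structure IsDerivedComplete {E : Type*} [AddCommGroup E] (φ : E →+ E) : Prop where
  exists_solution : ∀ y : ℕ → E, ∃ s : ℕ → E, ∀ n, s n = y n + φ (s (n + 1))
  eq_zero : ∀ s : ℕ → E, (∀ n, s n = φ (s (n + 1))) → ∀ n, s n = 0

/-- The cokernel of a morphism between derived complete groups is derived complete. -/
theorem IsDerivedComplete.of_exact {A B C : Type*} [AddCommGroup A] [AddCommGroup B]
    [AddCommGroup C] {φA : A →+ A} {φB : B →+ B} {φC : C →+ C}
    (hA : IsDerivedComplete φA) (hB : IsDerivedComplete φB) (f : A →+ B) (g : B →+ C)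
    (hf : ∀ a, f (φA a) = φB (f a)) (hg : ∀ b, g (φB b) = φC (g b))
    (hfg : ∀ a, g (f a) = 0) (hex : ∀ b, g b = 0 → ∃ a, f a = b)
    (hsurj : Function.Surjective g) : IsDerivedComplete φC where
  exists_solution y := by
    choose z hz using fun n => hsurj (y n)
    obtain ⟨s, hs⟩ := hB.exists_solution z
    exact ⟨fun n => g (s n), fun n => by rw [← hz n, ← hg, ← map_add, ← hs]⟩
  eq_zero s hs := by
    choose b hb using fun n => hsurj (s n)
    have hker : ∀ n, ∃ a, f a = b n - φB (b (n + 1)) := fun n => hex _ (by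
      rw [map_sub, hg, hb, hb, ← hs, sub_self])
    choose a ha using hker
    obtain ⟨t, ht⟩ := hA.exists_solution a
    -- The lifts `b` solve the homogeneous equations only up to `f (a n)`; solving the telescope for
    -- `a` in `A` corrects them.
    have key := hB.eq_zero (fun n => b n - f (t n)) (fun n => by
      rw [map_sub, ← hf]
      nth_rewrite 1 [ht n]
      rw [map_add, ha]
      abel)
    intro n
    rw [← hb, sub_eq_zero.1 (key n), hfg]

theorem IsDerivedComplete.of_addEquiv {A B : Type*} [AddCommGroup A] [AddCommGroup B]
    {φA : A →+ A} {φB : B →+ B} (hA : IsDerivedComplete φA) (e : A ≃+ B)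
    (he : ∀ a, e (φA a) = φB (e a)) : IsDerivedComplete φB :=
  IsDerivedComplete.of_exact hA hA (0 : A →+ A) e.toAddMonoidHom (by simp) he (by simp)
    (fun b hb => ⟨0, ((map_eq_zero_iff e e.injective).1 hb).symm⟩) e.surjective

/-- Nakayama's lemma for derived complete modules over power series, in the cyclic case. -/
theorem IsDerivedComplete.exists_smul_eq {k : Type*} [Field k] {E : Type*} [AddCommGroup E]
    [Module k⟦X⟧ E] {φ : E →+ E} (hE : IsDerivedComplete φ) (hφ : ∀ y, φ y = (X : k⟦X⟧) • y)
    (x : E) (hx : ∀ y : E, ∃ (c : k) (z : E), y = (C c : k⟦X⟧) • x + (X : k⟦X⟧) • z) (y : E) :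
    ∃ c : k⟦X⟧, y = c • x := by
  choose c g hcg using hx
  let z : ℕ → E := fun n => g^[n] y
  have hz : ∀ n, z n = (C (c (z n)) : k⟦X⟧) • x + (X : k⟦X⟧) • z (n + 1) := fun n => by
    rw [show z (n + 1) = g (z n) from Function.iterate_succ_apply' g n y]
    exact hcg _
  -- Successive approximation from `z n` yields one constant per step; these are the coefficients of
  -- the multiplier of `x`. The error `z n - w n • x` solves the homogeneous telescope.
  let w : ℕ → k⟦X⟧ := fun n => PowerSeries.mk fun j => c (z (n + j))
  have hw : ∀ n, w n = C (c (z n)) + X * w (n + 1) := fun n => by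
    ext j
    cases j with
    | zero => simp [w]
    | succ j =>
      rw [map_add, coeff_succ_X_mul, coeff_C, if_neg (Nat.succ_ne_zero j), zero_add]
      simp only [w, coeff_mk]
      rw [show n + (j + 1) = n + 1 + j by ring]
  have key := hE.eq_zero (fun n => z n - w n • x) (fun n => by
    rw [hφ, smul_sub, smul_smul]
    nth_rewrite 1 [hz n, hw n]
    rw [add_smul]
    abel)
  exact ⟨w 0, sub_eq_zero.1 (key 0)⟩

/-! ### Topologically free modules -/

theorem IsTopologicallyFree.exists_equiv {k : Type u} [Field k] {M : Type u}
    [AddCommGroup M] [Module k⟦X⟧ M] (hM : IsTopologicallyFree k M) :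
    ∃ (V : Type u) (_ : AddCommGroup V) (e : M ≃+ (ℕ → V)),
      (∀ m, e ((X : k⟦X⟧) • m) 0 = 0) ∧ ∀ m n, e ((X : k⟦X⟧) • m) (n + 1) = e m n := by
  obtain ⟨V, _, _, e, he⟩ := hM
  refine ⟨V, inferInstance, e, fun m => by simp [he], fun m n => ?_⟩
  rw [he, Finset.sum_eq_single (1, n)]
  · simp
  · rintro ⟨a, b⟩ hab hne
    have : a ≠ 1 := by
      rintro rfl
      refine hne (Prod.ext rfl ?_)
      have := Finset.HasAntidiagonal.mem_antidiagonal.1 hab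
      simp only at this ⊢
      omega
    simp [coeff_X, this]
  · exact fun hmem => absurd (Finset.HasAntidiagonal.mem_antidiagonal.2 (add_comm 1 n)) hmem

theorem IsTopologicallyFree.eq_zero_of_X_smul {k : Type u} [Field k] {M : Type u}
    [AddCommGroup M] [Module k⟦X⟧ M] (hM : IsTopologicallyFree k M) (m : M)
    (hm : (X : k⟦X⟧) • m = 0) : m = 0 := by
  obtain ⟨V, _, e, -, hs⟩ := hM.exists_equiv
  refine e.injective (funext fun n => ?_)
  rw [← hs, hm, map_zero]
  rfl

theorem IsTopologicallyFree.isDerivedComplete {k : Type u} [Field k] {M : Type u}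
    [AddCommGroup M] [Module k⟦X⟧ M] (hM : IsTopologicallyFree k M) :
    IsDerivedComplete (DistribSMul.toAddMonoidHom M (X : k⟦X⟧)) := by
  obtain ⟨V, _, e, h0, hs⟩ := hM.exists_equiv
  refine ⟨fun y => ?_, fun s hs' => ?_⟩
  · let t : ℕ → ℕ → V := fun j => Nat.rec (fun n => e (y n) 0)
      (fun j r n => e (y n) (j + 1) + r (n + 1)) j
    refine ⟨fun n => e.symm fun j => t j n, fun n => e.injective ?_⟩
    funext j
    cases j with
    | zero => simp [h0, t]
    | succ j => simp [hs, t]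
  · have : ∀ j n, e (s n) j = 0 := fun j => by
      induction j with
      | zero => exact fun n => by rw [hs' n]; exact h0 _
      | succ j ih => exact fun n => by rw [hs' n]; exact (hs _ _).trans (ih _)
    exact fun n => e.injective (by rw [map_zero]; funext j; exact this j n)

/-! ### Completeness of Ext -/

/-- The endomorphism of `Ext^n_R(M, R)` induced by right multiplication by `a`. -/
noncomputable def extMul {R : Type u} [Ring R] (a : R) (M : ModuleCat.{u} R) (n : ℕ) :
    Ext.{u} M (ModuleCat.of R R) n →+ Ext.{u} M (ModuleCat.of R R) n :=
  (Ext.mk₀ (rightMul a)).postcomp M (add_zero n)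

theorem extMul_apply {R : Type u} [Ring R] (a : R) (M : ModuleCat.{u} R) (n : ℕ)
    (x : Ext.{u} M (ModuleCat.of R R) n) :
    extMul a M n x = x.comp (Ext.mk₀ (rightMul a)) (add_zero n) := rfl

section

variable {R : Type u} [Ring R] {h : R}

/-- Solve pointwise in `R`; uniqueness of solutions forces the pointwise solutions to be linear in
`m`. -/
theorem isDerivedComplete_hom (hR : IsDerivedComplete (AddMonoidHom.mulRight h))
    (M : ModuleCat.{u} R) :
    IsDerivedComplete
      (Preadditive.rightComp M (rightMul h) :
        (M ⟶ ModuleCat.of R R) →+ (M ⟶ ModuleCat.of R R)) where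
  exists_solution y := by
    choose s hs using fun m : M => hR.exists_solution fun n => (y n).hom m
    have uniq : ∀ t : ℕ → R, (∀ n, t n = t (n + 1) * h) → ∀ n, t n = 0 := hR.eq_zero
    simp only [AddMonoidHom.mulRight_apply] at hs
    refine ⟨fun n => ModuleCat.ofHom
      { toFun := fun m => s m n
        map_add' := fun a b => ?_
        map_smul' := fun r a => ?_ }, fun n => ?_⟩
    · refine sub_eq_zero.1 (uniq (fun n => s (a + b) n - (s a n + s b n)) (fun n => ?_) n)
      nth_rewrite 1 [hs (a + b) n, hs a n, hs b n]
      rw [map_add]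
      noncomm_ring
    · refine sub_eq_zero.1 (uniq (fun n => s (r • a) n - r * s a n) (fun n => ?_) n)
      nth_rewrite 1 [hs (r • a) n, hs a n]
      rw [map_smul, smul_eq_mul]
      noncomm_ring
    · ext m
      exact hs m n
  eq_zero s hs n := by
    ext m
    exact hR.eq_zero (fun n => (s n).hom m)
      (fun n => congrArg (fun g : M ⟶ ModuleCat.of R R => g.hom m) (hs n)) n

/-- Dimension shifting: for 0 → Ω → P → M → 0 with P projective, Ext^(n+1)(M, R) is the cokernel of
Ext^n(P, R) → Ext^n(Ω, R). -/
theorem isDerivedComplete_ext (hR : IsDerivedComplete (AddMonoidHom.mulRight h)) (n : ℕ)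
    (M : ModuleCat.{u} R) :
    IsDerivedComplete (extMul h M n) := by
  induction n generalizing M with
  | zero =>
    refine (isDerivedComplete_hom hR M).of_addEquiv Ext.addEquiv₀.symm fun f => ?_
    exact (Ext.mk₀_comp_mk₀ f (rightMul h)).symm
  | succ n ih =>
    have hS := M.shortExact_projectiveShortComplex
    set S := M.projectiveShortComplex
    have : Projective S.X₂ := inferInstance
    refine IsDerivedComplete.of_exact (ih S.X₂) (ih S.X₁)
      ((Ext.mk₀ S.f).precomp _ (zero_add n)) (hS.extClass.precomp _ (by omega)) ?_ ?_ ?_ ?_ ?_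
    · intro a
      exact (Ext.comp_assoc_of_third_deg_zero _ _ _ (by omega)).symm
    · intro b
      exact (Ext.comp_assoc_of_third_deg_zero _ _ _ (by omega)).symm
    · intro a
      exact hS.extClass_comp_assoc a (h := by omega)
    · intro b hb
      exact Ext.contravariant_sequence_exact₁ hS _ b (by omega) hb
    · intro x
      exact Ext.contravariant_sequence_exact₃ hS _ x (Ext.eq_zero_of_projective _) (by omega)

end

/-! ### Change of rings -/

section

variable {R S : Type u} [Ring R] [Ring S] (f : R →+* S) (h : R)

/-- The morphism `π : M ⟶ M₀`, semilinear along `f`, exhibits `M₀` as the reduction modulo `h` of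
a module `M` without `h`-torsion. -/
structure IsReduction (f : R →+* S) (h : R) {M : ModuleCat.{u} R} {M₀ : ModuleCat.{u} S}
    (π : M ⟶ (ModuleCat.restrictScalars f).obj M₀) : Prop where
  eq_zero_of_smul : ∀ m : M, h • m = 0 → m = 0
  surjective : ∀ y : M₀, ∃ m : M, π.hom m = y
  exists_smul : ∀ m : M, π.hom m = 0 → ∃ m' : M, m = h • m'

theorem ModuleCat.restrictScalars_map_exact_of_exact (f : R →+* S)
    (T : ShortComplex (ModuleCat.{u} S)) (hT : T.Exact) :
    (T.map (ModuleCat.restrictScalars.{u} f)).Exact := by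
  rw [ShortComplex.ShortExact.moduleCat_exact_iff_function_exact] at hT ⊢
  exact hT

instance ModuleCat.restrictScalars_preservesFiniteLimits (f : R →+* S) :
    Limits.PreservesFiniteLimits (ModuleCat.restrictScalars.{u} f) := by
  have := ((Functor.exact_tfae (ModuleCat.restrictScalars.{u} f)).out 1 3).mp
    (ModuleCat.restrictScalars_map_exact_of_exact f)
  exact this.1

instance ModuleCat.restrictScalars_preservesFiniteColimits (f : R →+* S) :
    Limits.PreservesFiniteColimits (ModuleCat.restrictScalars.{u} f) := by
  have := ((Functor.exact_tfae (ModuleCat.restrictScalars.{u} f)).out 1 3).mp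
    (ModuleCat.restrictScalars_map_exact_of_exact f)
  exact this.2

/-- Change of rings in `Ext`: restrict scalars along `f`, then compose with `π`. -/
noncomputable def extChange {f : R →+* S} {M : ModuleCat.{u} R} {M₀ : ModuleCat.{u} S}
    (π : M ⟶ (ModuleCat.restrictScalars f).obj M₀) (N : ModuleCat.{u} S) (n : ℕ) :
    Ext.{u} M₀ N n →+ Ext.{u} M ((ModuleCat.restrictScalars f).obj N) n :=
  ((Ext.mk₀ π).precomp _ (zero_add n)).comp ((ModuleCat.restrictScalars f).mapExtAddHom M₀ N n)

variable {f}

theorem extChange_apply {M : ModuleCat.{u} R} {M₀ : ModuleCat.{u} S}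
    (π : M ⟶ (ModuleCat.restrictScalars f).obj M₀) (N : ModuleCat.{u} S) (n : ℕ)
    (x : Ext.{u} M₀ N n) :
    extChange π N n x =
      (Ext.mk₀ π).comp (x.mapExactFunctor (ModuleCat.restrictScalars f)) (zero_add n) := rfl

theorem extChange_comp_mk₀ {M : ModuleCat.{u} R} {M₀ : ModuleCat.{u} S}
    (π : M ⟶ (ModuleCat.restrictScalars f).obj M₀) {N N' : ModuleCat.{u} S} (g : N ⟶ N') (n : ℕ)
    (x : Ext.{u} M₀ N n) :
    extChange π N' n (x.comp (Ext.mk₀ g) (add_zero n)) =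
      (extChange π N n x).comp (Ext.mk₀ ((ModuleCat.restrictScalars f).map g)) (add_zero n) := by
  rw [extChange_apply, extChange_apply, Ext.mapExactFunctor_comp, Ext.mapExactFunctor_mk₀,
    Ext.comp_assoc_of_third_deg_zero]

/-- Applied below to extension classes, where it says that change of rings commutes with connecting
maps. -/
theorem extChange_comp {M L : ModuleCat.{u} R} {M₀ L₀ : ModuleCat.{u} S}
    {π : M ⟶ (ModuleCat.restrictScalars f).obj M₀}
    {ρ : L ⟶ (ModuleCat.restrictScalars f).obj L₀} {N : ModuleCat.{u} S} {a n m : ℕ}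
    (α₀ : Ext.{u} M₀ L₀ a) (α : Ext.{u} M L a)
    (hα : α.comp (Ext.mk₀ ρ) (add_zero a) =
      (Ext.mk₀ π).comp (α₀.mapExactFunctor (ModuleCat.restrictScalars f)) (zero_add a))
    (hm : a + n = m) (x : Ext.{u} L₀ N n) :
    extChange π N m (α₀.comp x hm) = α.comp (extChange ρ N n x) hm := by
  rw [extChange_apply, extChange_apply, Ext.mapExactFunctor_comp,
    ← Ext.comp_assoc _ _ _ (zero_add a) hm (by omega), ← hα,
    Ext.comp_assoc _ _ _ (add_zero a) (zero_add n) (by omega)]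

theorem extChange_bijective_zero (hf : Function.Surjective f) (hfh : f h = 0)
    {M : ModuleCat.{u} R} {M₀ : ModuleCat.{u} S}
    {π : M ⟶ (ModuleCat.restrictScalars f).obj M₀} (hπ : IsReduction f h π) (N : ModuleCat.{u} S) :
    Function.Bijective (extChange π N 0) := by
  have key : ∀ g : M₀ ⟶ N, extChange π N 0 (Ext.mk₀ g) =
      Ext.mk₀ (π ≫ (ModuleCat.restrictScalars f).map g) := fun g => by
    rw [extChange_apply, Ext.mapExactFunctor_mk₀, Ext.mk₀_comp_mk₀]
  constructor
  · rw [injective_iff_map_eq_zero]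
    intro x hx
    obtain ⟨g, rfl⟩ := (Ext.mk₀_bijective _ _).2 x
    rw [key, Ext.mk₀_eq_zero_iff] at hx
    rw [Ext.mk₀_eq_zero_iff]
    ext y
    obtain ⟨m, rfl⟩ := hπ.surjective y
    exact congrArg (fun g : M ⟶ (ModuleCat.restrictScalars f).obj N => g.hom m) hx
  · intro x
    obtain ⟨g, rfl⟩ := (Ext.mk₀_bijective _ _).2 x
    have hg0 : ∀ m, π.hom m = 0 → g.hom m = 0 := fun m hm => by
      obtain ⟨m', rfl⟩ := hπ.exists_smul m hm
      rw [map_smul]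
      refine (ModuleCat.restrictScalars.smul_def f h (g.hom m')).trans ?_
      rw [hfh]
      exact zero_smul S (show N from g.hom m')
    choose s hs using hπ.surjective
    have hg : ∀ m m', π.hom m = π.hom m' → g.hom m = g.hom m' := fun m m' hmm => by
      rw [← sub_eq_zero, ← map_sub]
      exact hg0 _ (by rw [map_sub, hmm, sub_self])
    refine ⟨Ext.mk₀ (ModuleCat.ofHom (X := M₀) (Y := N)
      { toFun := fun y => g.hom (s y)
        map_add' := fun a b => ?_
        map_smul' := fun c a => ?_ }), ?_⟩
    · refine (hg _ (s a + s b) ?_).trans (map_add _ _ _)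
      rw [map_add, hs]
      exact congrArg₂ (· + ·) (hs a).symm (hs b).symm
    · obtain ⟨r, rfl⟩ := hf c
      refine (hg _ (r • s a) ?_).trans (map_smul _ _ _)
      rw [map_smul, hs]
      exact congrArg (fun z : M₀ => f r • z) (hs a).symm
    · rw [key]
      congr 1
      ext m
      exact hg _ _ (hs _)

/-- The free presentation of a module with a reduction, together with its reduction. -/
theorem IsReduction.exists_presentation (hf : Function.Surjective f)
    (hreg : ∀ a, h * a = 0 → a = 0) (hker : ∀ a, f a = 0 ↔ ∃ b, a = h * b)
    {M : ModuleCat.{u} R} {M₀ : ModuleCat.{u} S}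
    {π : M ⟶ (ModuleCat.restrictScalars f).obj M₀} (hπ : IsReduction f h π) :
    ∃ (P Ω : ModuleCat.{u} R) (P₀ Ω₀ : ModuleCat.{u} S) (i : Ω ⟶ P) (q : P ⟶ M)
      (i₀ : Ω₀ ⟶ P₀) (q₀ : P₀ ⟶ M₀) (w : i ≫ q = 0) (w₀ : i₀ ≫ q₀ = 0)
      (πP : P ⟶ (ModuleCat.restrictScalars f).obj P₀)
      (πΩ : Ω ⟶ (ModuleCat.restrictScalars f).obj Ω₀),
      (ShortComplex.mk i q w).ShortExact ∧ (ShortComplex.mk i₀ q₀ w₀).ShortExact ∧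
      Projective P ∧ Projective P₀ ∧ IsReduction f h πP ∧ IsReduction f h πΩ ∧
      πΩ ≫ (ModuleCat.restrictScalars f).map i₀ = i ≫ πP ∧
      πP ≫ (ModuleCat.restrictScalars f).map q₀ = q ≫ π := by
  let q : (M →₀ R) →ₗ[R] M := Finsupp.linearCombination R id
  let q₀ : (M →₀ S) →ₗ[S] M₀ := Finsupp.linearCombination S (fun m => (π.hom m : M₀))
  have hq : Function.Surjective q := fun m => ⟨Finsupp.single m 1, by simp [q]⟩
  have hq₀ : Function.Surjective q₀ := fun y => by
    obtain ⟨m, hm⟩ := hπ.surjective y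
    exact ⟨Finsupp.single m 1, 
      (Finsupp.linearCombination_single _ _ _).trans ((one_smul _ _).trans hm)⟩
  let r : (M →₀ R) →+ (M →₀ S) := Finsupp.mapRange.addMonoidHom f.toAddMonoidHom
  have hr : ∀ (p : M →₀ R) (m : M), r p m = f (p m) := fun p m => rfl
  have hrs : ∀ (a : R) (p : M →₀ R), r (a • p) = f a • r p := fun a p => by
    ext m
    simp [hr]
  have hrsurj : Function.Surjective r := Finsupp.mapRange_surjective f (map_zero f) hf
  have hcomm : ∀ p, q₀ (r p) = π.hom (q p) := fun p => by
    induction p using Finsupp.induction_linear with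
    | zero => simp only [map_zero]; rfl
    | add a b ha hb =>
      rw [map_add, map_add, ha, hb, map_add, map_add]
      rfl
    | single m a =>
      have : r (Finsupp.single m a) = Finsupp.single m (f a) :=
        Finsupp.mapRange_single (hf := map_zero f)
      rw [this, show q (Finsupp.single m a) = a • m from Finsupp.linearCombination_single _ _ _,
        map_smul]
      exact Finsupp.linearCombination_single _ _ _
  have hrker : ∀ p, r p = 0 → ∃ p', p = h • p' := fun p hp => by
    have : ∀ m, ∃ b, p m = h * b := fun m => (hker _).1 (by rw [← hr, hp]; rfl)
    choose b hb using this
    -- Regularity of `h` makes `b` vanish wherever `p` does, so it is finitely supported.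
    refine ⟨Finsupp.onFinset p.support b fun m hm => ?_, ?_⟩
    · rw [Finsupp.mem_support_iff]
      exact fun h0 => hm (hreg _ (by rw [← hb, h0]))
    · ext m
      exact hb m
  have hPtf : ∀ p : M →₀ R, h • p = 0 → p = 0 := fun p hp => by
    ext m
    exact hreg _ (DFunLike.congr_fun hp m)
  let rΩ : LinearMap.ker q →+ LinearMap.ker q₀ :=
    { toFun := fun p => ⟨r p, by
        rw [LinearMap.mem_ker, hcomm, LinearMap.mem_ker.1 p.2]
        exact map_zero π.hom⟩
      map_zero' := by ext; simp
      map_add' := fun a b => by ext; simp }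
  have hfh : f h = 0 := (hker h).2 ⟨1, (mul_one h).symm⟩
  -- Absence of `h`-torsion in `M` gives Ω ∩ hP = hΩ, so the syzygy Ω reduces to `Ω₀`.
  have hsmul : ∀ p, q (h • p) = 0 → q p = 0 := fun p hp => hπ.eq_zero_of_smul _ (by
    rw [← map_smul, hp])
  refine ⟨ModuleCat.of R (M →₀ R), ModuleCat.of R (LinearMap.ker q), ModuleCat.of S (M →₀ S),
    ModuleCat.of S (LinearMap.ker q₀), ModuleCat.ofHom (LinearMap.ker q).subtype, ModuleCat.ofHom q,
    ModuleCat.ofHom (LinearMap.ker q₀).subtype, ModuleCat.ofHom q₀, by ext x; exact x.2,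
    by ext x; exact x.2,
    ModuleCat.ofHom (Y := (ModuleCat.restrictScalars f).obj (ModuleCat.of S (M →₀ S)))
      { toFun := r
        map_add' := map_add r
        map_smul' := hrs },
    ModuleCat.ofHom (Y := (ModuleCat.restrictScalars f).obj (ModuleCat.of S (LinearMap.ker q₀)))
      { toFun := rΩ
        map_add' := map_add rΩ
        map_smul' := fun a p => Subtype.ext (hrs a p) },
    LinearMap.shortExact_shortComplexKer hq, LinearMap.shortExact_shortComplexKer hq₀,
    inferInstance, inferInstance, ⟨hPtf, hrsurj, hrker⟩, ⟨?_, ?_, ?_⟩, rfl, ?_⟩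
  · exact fun p hp => Subtype.ext (hPtf _ (congrArg Subtype.val hp))
  · rintro ⟨y, hy⟩
    obtain ⟨p, rfl⟩ := hrsurj y
    rw [LinearMap.mem_ker, hcomm] at hy
    obtain ⟨m, hm⟩ := hπ.exists_smul _ hy
    obtain ⟨p', rfl⟩ := hq m
    -- The lift `p` need only map into hM; subtracting `h • p'` moves it into the kernel without
    -- changing its reduction.
    refine ⟨⟨p - h • p', ?_⟩, Subtype.ext ?_⟩
    · rw [LinearMap.mem_ker, map_sub, map_smul, hm, sub_self]
    · change r (p - h • p') = r p
      rw [map_sub, hrs, hfh, zero_smul, sub_zero]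
  · rintro ⟨p, hp⟩ hp0
    obtain ⟨p', rfl⟩ := hrker p (congrArg Subtype.val hp0)
    exact ⟨⟨p', hsmul _ hp⟩, rfl⟩
  · ext p
    exact hcomm _

/-- Dimension shifting along compatible presentations: injectivity uses the previous degree for both
P and Ω, surjectivity only for Ω. -/
theorem extChange_bijective (hf : Function.Surjective f)
    (hreg : ∀ a, h * a = 0 → a = 0) (hker : ∀ a, f a = 0 ↔ ∃ b, a = h * b) (N : ModuleCat.{u} S)
    (n : ℕ) {M : ModuleCat.{u} R} {M₀ : ModuleCat.{u} S}
    {π : M ⟶ (ModuleCat.restrictScalars f).obj M₀} (hπ : IsReduction f h π) :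
    Function.Bijective (extChange π N n) := by
  induction n generalizing M M₀ with
  | zero => exact extChange_bijective_zero h hf ((hker h).2 ⟨1, (mul_one h).symm⟩) hπ N
  | succ n ih =>
    obtain ⟨P, Ω, P₀, Ω₀, i, q, i₀, q₀, w, w₀, πP, πΩ, hT, hT₀, _, _, hP, hΩ, hi, hq⟩ :=
      hπ.exists_presentation h hf hreg hker
    let φ : ShortComplex.mk i q w ⟶
        (ShortComplex.mk i₀ q₀ w₀).map (ModuleCat.restrictScalars f) :=
      { τ₁ := πΩ, τ₂ := πP, τ₃ := π, comm₁₂ := hi, comm₂₃ := hq }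
    have hδ : ∀ x, extChange π N (n + 1) (hT₀.extClass.comp x (by omega)) =
        hT.extClass.comp (extChange πΩ N n x) (by omega) := fun x =>
      extChange_comp _ _ ((ShortComplex.ShortExact.extClass_naturality hT
        (hT₀.map_of_exact (ModuleCat.restrictScalars f)) φ).trans
          (congrArg (fun c => (Ext.mk₀ π).comp c (zero_add 1))
            (Ext.mapExactFunctor_extClass (ModuleCat.restrictScalars f) hT₀).symm)) (by omega) x
    constructor
    · rw [injective_iff_map_eq_zero]
      intro x hx
      obtain ⟨x', rfl⟩ := Ext.contravariant_sequence_exact₃ hT₀ _ x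
        (Ext.eq_zero_of_projective (P := P₀) _) (show 1 + n = n + 1 by omega)
      rw [hδ] at hx
      obtain ⟨z, hz⟩ := Ext.contravariant_sequence_exact₁ hT _ _ (by omega) hx
      obtain ⟨z, rfl⟩ := (ih hP).2 z
      have : (Ext.mk₀ i₀).comp z (zero_add n) = x' := (ih hΩ).1
        ((extChange_comp _ (Ext.mk₀ i) (by
          rw [Ext.mapExactFunctor_mk₀, Ext.mk₀_comp_mk₀, Ext.mk₀_comp_mk₀, hi]) _ z).trans hz)
      rw [← this]
      exact hT₀.extClass_comp_assoc z
    · intro y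
      obtain ⟨y, rfl⟩ := Ext.contravariant_sequence_exact₃ hT _ y
        (Ext.eq_zero_of_projective (P := P) _) (show 1 + n = n + 1 by omega)
      obtain ⟨x, rfl⟩ := (ih hΩ).2 y
      exact ⟨_, hδ x⟩

end

/-! ### Right action and reduction modulo h of Ext -/

theorem op_smul_ext {R : Type u} [Ring R] {M : Type u} [AddCommGroup M] [Module R M] {n : ℕ}
    (a : R) (x : ExtSelf R M n) : op a • x = extMul a (ModuleCat.of R M) n x := rfl

theorem smul_ext_eq_op_smul {R₀ R : Type u} [CommRing R₀] [Ring R] [Algebra R₀ R] {M : Type u}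
    [AddCommGroup M] [Module R M] {n : ℕ} (c : R₀) (x : ExtSelf R M n) :
    c • x = op (algebraMap R₀ R c) • x := by
  refine (Ext.smul_eq_comp_mk₀ x c).trans ?_
  rw [op_smul_ext, extMul_apply]
  congr 2
  ext
  change algebraMap R₀ R c * 1 = 1 * algebraMap R₀ R c
  rw [mul_one, one_mul]

theorem op_smul_smul_ext {R₀ R : Type u} [CommRing R₀] [Ring R] [Algebra R₀ R] {M : Type u}
    [AddCommGroup M] [Module R M] {n : ℕ} (a : R) (c : R₀) (x : ExtSelf R M n) :
    op a • c • x = c • op a • x := by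
  rw [smul_ext_eq_op_smul, smul_ext_eq_op_smul, ← mul_smul, ← mul_smul, ← op_mul, ← op_mul,
    Algebra.commutes]

/-- The ring homomorphism `f : R → S`, as a morphism of left `R`-modules. -/
noncomputable def ringHomToRestrictScalars {R S : Type u} [Ring R] [Ring S] (f : R →+* S) :
    ModuleCat.of R R ⟶ (ModuleCat.restrictScalars f).obj (ModuleCat.of S S) :=
  ModuleCat.ofHom (Y := (ModuleCat.restrictScalars f).obj (ModuleCat.of S S))
    { toFun := f
      map_add' := map_add f
      map_smul' := map_mul f }

section

variable {R S : Type u} [Ring R] [Ring S] {f : R →+* S} {h : R}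

theorem rightMul_comp_ringHomToRestrictScalars (a : R) :
    rightMul a ≫ ringHomToRestrictScalars f =
      ringHomToRestrictScalars f ≫ (ModuleCat.restrictScalars f).map (rightMul (f a)) := by
  ext
  exact map_mul f _ _

theorem exists_shortExact (hf : Function.Surjective f) (hc : ∀ a, h * a = a * h)
    (hreg : ∀ a, h * a = 0 → a = 0) (hker : ∀ a, f a = 0 ↔ ∃ b, a = h * b) :
    ∃ w : rightMul h ≫ ringHomToRestrictScalars f = 0,
      (ShortComplex.mk (rightMul h) (ringHomToRestrictScalars f) w).ShortExact := by
  have w : rightMul h ≫ ringHomToRestrictScalars f = 0 := by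
    ext
    exact (hker _).2 ⟨_, (hc _).symm⟩
  refine ⟨w, ?_⟩
  have : Mono (rightMul h) := by
    rw [ModuleCat.mono_iff_injective, injective_iff_map_eq_zero]
    exact fun a ha => hreg a ((hc a).trans ha)
  have : Epi (ringHomToRestrictScalars f) := by
    rw [ModuleCat.epi_iff_surjective]
    exact hf
  refine { exact := ?_ }
  rw [ShortComplex.moduleCat_exact_iff]
  intro x hx
  obtain ⟨b, hb⟩ := (hker x).1 hx
  exact ⟨b, ((hc b).symm.trans hb.symm)⟩

/-- The reduction modulo `h` of `Ext^n_R(M, R)`. -/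
theorem exists_ext_reduction (hf : Function.Surjective f) (hc : ∀ a, h * a = a * h)
    (hreg : ∀ a, h * a = 0 → a = 0) (hker : ∀ a, f a = 0 ↔ ∃ b, a = h * b)
    {M M₀ : Type u} [AddCommGroup M] [AddCommGroup M₀] [Module R M] [Module S M₀]
    {π : ModuleCat.of R M ⟶ (ModuleCat.restrictScalars f).obj (ModuleCat.of S M₀)}
    (hπ : IsReduction f h π) (n : ℕ) :
    ∃ p : ExtSelf R M n →+ ExtSelf S M₀ n,
      (∀ x, p x = 0 ↔ ∃ y, x = op h • y) ∧
      (∀ (a : R) x, p (op a • x) = op (f a) • p x) ∧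
      (Subsingleton (ExtSelf R M (n + 1)) → Function.Surjective p) := by
  obtain ⟨w, hT⟩ := exists_shortExact hf hc hreg hker
  let e := AddEquiv.ofBijective (extChange π (ModuleCat.of S S) n)
    (extChange_bijective h hf hreg hker _ n hπ)
  let q := (Ext.mk₀ (ringHomToRestrictScalars f)).postcomp (ModuleCat.of R M) (add_zero n)
  refine ⟨e.symm.toAddMonoidHom.comp q, fun x => ?_, fun a x => ?_, fun hsub y => ?_⟩
  · refine (map_eq_zero_iff e.symm e.symm.injective).trans ⟨fun hx => ?_, ?_⟩
    · obtain ⟨y, hy⟩ := Ext.covariant_sequence_exact₂ _ hT x hx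
      exact ⟨y, hy.symm⟩
    · rintro ⟨y, rfl⟩
      change (y.comp (Ext.mk₀ (rightMul h)) (add_zero n)).comp
        (Ext.mk₀ (ringHomToRestrictScalars f)) (add_zero n) = 0
      rw [Ext.comp_assoc_of_third_deg_zero, Ext.mk₀_comp_mk₀, w, Ext.mk₀_zero, Ext.comp_zero]
  · refine e.injective ((e.apply_symm_apply _).trans ?_)
    refine Eq.trans ?_ (extChange_comp_mk₀ π (rightMul (f a)) n (e.symm (q x))).symm
    change (x.comp (Ext.mk₀ (rightMul a)) (add_zero n)).comp
        (Ext.mk₀ (ringHomToRestrictScalars f)) (add_zero n) =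
      (e (e.symm (q x))).comp _ (add_zero n)
    rw [e.apply_symm_apply, Ext.comp_assoc_of_third_deg_zero, Ext.mk₀_comp_mk₀,
      rightMul_comp_ringHomToRestrictScalars, ← Ext.mk₀_comp_mk₀,
      ← Ext.comp_assoc_of_third_deg_zero]
    rfl
  · obtain ⟨x, hx⟩ := Ext.covariant_sequence_exact₃ _ hT (e y) rfl (hsub.elim _ _)
    exact ⟨x, (congrArg e.symm hx).trans (e.symm_apply_apply y)⟩

/-- The `h`-torsion is the image of the connecting map from degree `n - 1`; in degree 0
multiplication by `h` is mono. -/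
theorem ext_eq_zero_of_op_smul (hf : Function.Surjective f) (hc : ∀ a, h * a = a * h)
    (hreg : ∀ a, h * a = 0 → a = 0) (hker : ∀ a, f a = 0 ↔ ∃ b, a = h * b)
    {M M₀ : Type u} [AddCommGroup M] [AddCommGroup M₀] [Module R M] [Module S M₀]
    {π : ModuleCat.of R M ⟶ (ModuleCat.restrictScalars f).obj (ModuleCat.of S M₀)}
    (hπ : IsReduction f h π) (n : ℕ) (hn : ∀ i, i + 1 = n → Subsingleton (ExtSelf S M₀ i))
    (x : ExtSelf R M n) (hx : op h • x = 0) : x = 0 := by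
  obtain ⟨w, hT⟩ := exists_shortExact hf hc hreg hker
  cases n with
  | zero =>
    have := hT.mono_f
    exact Ext.postcomp_mk₀_injective_of_mono (ModuleCat.of R M) (rightMul h)
      (hx.trans (map_zero _).symm)
  | succ n =>
    obtain ⟨y, rfl⟩ := Ext.covariant_sequence_exact₁ _ hT x hx rfl
    obtain ⟨z, rfl⟩ := (extChange_bijective h hf hreg hker _ n hπ).2 y
    rw [(hn n rfl).elim z 0, map_zero, Ext.zero_comp]

end

/-! ### The character and the main theorem -/

theorem existsUnique_character {K R : Type u} [CommRing K] [Ring R] [Algebra K R] {M : Type u}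
    [AddCommGroup M] [Module R M] {n : ℕ} (e : ExtSelf R M n)
    (hgen : ∀ y, ∃ c : K, y = c • e) (hann : ∀ c : K, c • e = 0 → c = 0) :
    ∃! θ : R →ₐ[K] K, ∀ (a : R) (x : ExtSelf R M n), op a • x = θ a • x := by
  have hinj : ∀ c c' : K, c • e = c' • e → c = c' := fun c c' hcc =>
    sub_eq_zero.1 (hann _ (by rw [sub_smul, hcc, sub_self]))
  choose θ hθ using fun a : R => hgen (op a • e)
  have hact : ∀ (a : R) (x : ExtSelf R M n), op a • x = θ a • x := fun a x => by
    obtain ⟨c, rfl⟩ := hgen x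
    rw [op_smul_smul_ext, hθ, smul_comm]
  have halg : ∀ c : K, θ (algebraMap K R c) = c := fun c =>
    hinj _ _ (by rw [← hθ, smul_ext_eq_op_smul])
  refine ⟨{ toFun := θ
            map_one' := by simpa using halg 1
            map_mul' := fun a b => hinj _ _ (by
              rw [← hθ, op_mul, mul_smul, hact a e, hact b, smul_smul, mul_comm])
            map_zero' := by simpa using halg 0
            map_add' := fun a b => hinj _ _ (by
              rw [← hθ, MulOpposite.op_add, add_smul, hact a, hact b, add_smul])
            commutes' := halg }, hact, fun θ' hθ' => ?_⟩
  ext a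
  exact hinj _ _ (by rw [← hθ', hθ]; rfl)

theorem mainTheorem1
    (k : Type u) [Field k] [CharZero k]
    (A₀ : Type u) [Ring A₀] [Algebra k A₀] [IsNoetherianRing A₀]
    (Ah : Type u) [Ring Ah] [Algebra k⟦X⟧ Ah] (D : Deformation k A₀ Ah)
    [Module A₀ k] [IsScalarTower k A₀ k]
    (d : ℕ)
    (hExt : ∀ i : ℕ, i ≠ d → Subsingleton (ExtSelf A₀ k i))
    (hExtd : Nonempty (ExtSelf A₀ k d ≃ₗ[k] k))
    [Module Ah k⟦X⟧] [IsScalarTower k⟦X⟧ Ah k⟦X⟧]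
    (hred : ∀ (a : Ah) (f : k⟦X⟧), constantCoeff (a • f) = D.red a • constantCoeff f) :
    (∀ i : ℕ, i ≠ d → Subsingleton (ExtSelf Ah k⟦X⟧ i)) ∧
    (Module.Free k⟦X⟧ (ExtSelf Ah k⟦X⟧ d) ∧ Module.rank k⟦X⟧ (ExtSelf Ah k⟦X⟧ d) = 1) ∧
    (∃ p : ExtSelf Ah k⟦X⟧ d →+ ExtSelf A₀ k d,
      Function.Surjective p ∧
      (∀ x, p x = 0 ↔ ∃ y, x = (X : k⟦X⟧) • y) ∧
      (∀ (c : k⟦X⟧) x, p (c • x) = constantCoeff c • p x) ∧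
      (∀ (a : Ah) x, p (op a • x) = op (D.red a) • p x)) ∧
    (∃! θ : Ah →ₐ[k⟦X⟧] k⟦X⟧, ∀ (a : Ah) (x : ExtSelf Ah k⟦X⟧ d), op a • x = θ a • x) := by
  let h : Ah := algebraMap k⟦X⟧ Ah X
  have hc : ∀ a, h * a = a * h := Algebra.commutes X
  have hX : ∀ a : Ah, (X : k⟦X⟧) • a = h * a := Algebra.smul_def X
  have hreg : ∀ a, h * a = 0 → a = 0 := fun a ha =>
    D.topologicallyFree.eq_zero_of_X_smul a ((hX a).trans ha)
  have hker : ∀ a, D.red a = 0 ↔ ∃ b, a = h * b := fun a => by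
    simp only [D.red_eq_zero_iff, hX]
  let κ : k⟦X⟧ →+* k := constantCoeff
  let π : ModuleCat.of Ah k⟦X⟧ ⟶ (ModuleCat.restrictScalars D.red).obj (ModuleCat.of A₀ k) :=
    ModuleCat.ofHom (Y := (ModuleCat.restrictScalars D.red).obj (ModuleCat.of A₀ k))
      { toFun := fun c => κ c
        map_add' := fun a b => show κ (a + b) = κ a + κ b from map_add κ a b
        map_smul' := hred }
  have hXK : ∀ c : k⟦X⟧, h • c = X * c := fun c => algebraMap_smul Ah X c
  have hπ : IsReduction D.red h π :=
    { eq_zero_of_smul := fun c hc0 =>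
        (mul_eq_zero.1 ((hXK c).symm.trans hc0)).resolve_left X_ne_zero
      surjective := fun y => ⟨C y, constantCoeff_C y⟩
      exists_smul := fun c hc0 => by
        obtain ⟨b, rfl⟩ := X_dvd_iff.2 (show κ c = 0 from hc0)
        exact ⟨b, (hXK b).symm⟩ }
  have hcomplete : ∀ n, IsDerivedComplete (extMul h (ModuleCat.of Ah k⟦X⟧) n) := fun n =>
    isDerivedComplete_ext (D.topologicallyFree.isDerivedComplete.of_addEquiv (AddEquiv.refl Ah)
      fun a => (hX a).trans (hc a)) n _
  have hsmulX : ∀ (n : ℕ) (x : ExtSelf Ah k⟦X⟧ n), op h • x = (X : k⟦X⟧) • x := fun n x =>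
    (smul_ext_eq_op_smul X x).symm
  choose p hp0 hpa hps using exists_ext_reduction D.red_surjective hc hreg hker hπ
  simp only [hsmulX] at hp0
  have hvan : ∀ i : ℕ, i ≠ d → Subsingleton (ExtSelf Ah k⟦X⟧ i) := fun i hi => by
    have := hExt i hi
    refine subsingleton_of_forall_eq 0 fun y => ?_
    -- Nakayama with generator 0: Ext equals its multiple by `X`.
    obtain ⟨c, hc⟩ := (hcomplete i).exists_smul_eq (hsmulX i) 0 (fun y => by
      obtain ⟨z, hz⟩ := (hp0 i y).1 (Subsingleton.elim _ _)
      exact ⟨0, z, by rw [smul_zero, zero_add, hz]⟩) y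
    rw [hc, smul_zero]
  have hsurj : Function.Surjective (p d) := hps d (hvan _ (Nat.succ_ne_self d))
  have hpc : ∀ (c : k⟦X⟧) x, p d (c • x) = constantCoeff c • p d x := fun c x => by
    rw [smul_ext_eq_op_smul, hpa, D.red_algebraMap, ← smul_ext_eq_op_smul]
  obtain ⟨ε⟩ := hExtd
  obtain ⟨e, he⟩ := hsurj (ε.symm 1)
  have he0 : p d e ≠ 0 := by
    rw [he]
    simp
  have hgen : ∀ y, ∃ c : k⟦X⟧, y = c • e :=
    (hcomplete d).exists_smul_eq (hsmulX d) e fun y => by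
      obtain ⟨z, hz⟩ := (hp0 d (y - (C (ε (p d y)) : k⟦X⟧) • e)).1 (by
        rw [map_sub, hpc, constantCoeff_C, he, ← map_smul, smul_eq_mul, mul_one,
          LinearEquiv.symm_apply_apply, sub_self])
      exact ⟨_, z, by rw [← hz]; abel⟩
  have htf : ∀ x : ExtSelf Ah k⟦X⟧ d, (X : k⟦X⟧) • x = 0 → x = 0 := fun x hx =>
    ext_eq_zero_of_op_smul D.red_surjective hc hreg hker hπ d
      (fun i hi => hExt i (by omega)) x ((hsmulX d x).trans hx)
  -- Reducing modulo `X` kills the constant term of `c`; torsion-freeness then allows division by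
  -- `X`, one coefficient at a time.
  have hann : ∀ c : k⟦X⟧, c • e = 0 → c = 0 := fun c hce => by
    ext n
    induction n generalizing c with
    | zero =>
      have := hpc c e
      rw [hce, map_zero] at this
      rw [coeff_zero_eq_constantCoeff_apply, map_zero]
      exact (smul_eq_zero.1 this.symm).resolve_right he0
    | succ n ih =>
      have hc0 : constantCoeff c = 0 := by
        have := hpc c e
        rw [hce, map_zero] at this
        exact (smul_eq_zero.1 this.symm).resolve_right he0
      obtain ⟨b, rfl⟩ := X_dvd_iff.2 hc0
      rw [coeff_succ_X_mul]
      exact ih b (htf _ (by rw [smul_smul, hce]))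
  let E : k⟦X⟧ ≃ₗ[k⟦X⟧] ExtSelf Ah k⟦X⟧ d :=
    LinearEquiv.ofBijective (LinearMap.toSpanSingleton k⟦X⟧ _ e)
      ⟨(injective_iff_map_eq_zero _).2 hann, fun y => (hgen y).imp fun _ hc => hc.symm⟩
  exact ⟨hvan, ⟨Module.Free.of_equiv E, E.symm.rank_eq.trans (Module.rank_self _)⟩,
    ⟨p d, hsurj, hp0 d, hpc, hpa d⟩, existsUnique_character e hgen hann⟩
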